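/- For $n=2,3$ let $B_n(\mathbb{R}P^2)$ be the $n$-strand braid group of the projective plane, given by the presentations $$B_2(\mathbb{R}P^2)=\langle \sigma_1,\rho \mid \sigma_1^{-1}\rho\sigma_1^{-1}\rho=\rho\sigma_1^{-1}\rho\sigma_1,\ \rho^2=\sigma_1^2\rangle,$$ $$B_3(\mathbb{R}P^2)=\langle \sigma_1,\sigma_2,\rho \mid \sigma_1\sigma_2\sigma_1=\sigma_2\sigma_1\sigma_2,\ \rho\sigma_2=\sigma_2\rho,\ \sigma_1^{-1}\rho\sigma_1^{-1}\rho=\rho\sigma_1^{-1}\rho\sigma_1,\ \rho^2=\sigma_1\sigma_2^2\sigma_1\rangle .$$ Each braid has a permutation, $\sigma_i\mapsto(i,i+1)$, $\rho\mapsto e$; the pure braids are those with trivial permutation. Let $d_i\colon B_3(\mathbb{R}P^2)\to B_2(\mathbb{R}P^2)$, $i=1,2,3$, be the removal of the $i$-th strand. It is determined by $d_i(\beta\gamma)=d_i(\beta)\,d_{i\cdot\beta}(\gamma)$, where $i\cdot\beta$ is the final position of the strand of $\beta$ that starts at position $i$, and by $$d_1\sigma_1=d_2\sigma_1=1,\quad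 d_3\sigma_1=\sigma_1,\quad d_1\sigma_2=\sigma_1,\quad d_2\sigma_2=d_3\sigma_2=1,\quad d_1\rho=1,\quad d_2\rho=d_3\rho=\rho .$$ Let $\mathfrak{H}_3(\mathbb{R}P^2)$ be the group of pure braids $\beta\in B_3(\mathbb{R}P^2)$ with $d_1\beta=d_2\beta=d_3\beta$ (pure Cohen braids). Put $$u=\sigma_1\rho\sigma_1^{-1},\qquad w=\sigma_2\sigma_1\rho\sigma_1^{-1}\sigma_2^{-1},\qquad A_{23}=\sigma_2^2,\qquad [a,b]=a^{-1}b^{-1}ab .$$ **Lemma.** The group $\mathfrak{H}_3(\mathbb{R}P^2)$ is generated by $\rho u w$ and the nine elements $$w^4,\quad A_{23}^2,\quad [w^4,A_{23}],\quad [A_{23},w],\quad [A_{23},w^2],\quad [A_{23},w^3],$$ $$[[A_{23},w],A_{23}],\quad [[A_{23},w^2],A_{23}],\quad [[A_{23},w^3],A_{23}].$$ In particular, $\mathfrak{H}_3(\mathbb{R}P^2)$ is finitely generated. In contrast, the group $\mathfrak{H}_3$ of pure Cohen braids of the disc on three strands, defined in the same way from the Artin braid groups $B_3=\langle\sigma_1,\sigma_2\mid\sigma_1\sigma_2\sigma_1=\sigma_2\sigma_1\sigma_2\rangle$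 and $B_2=\langle\sigma_1\rangle\cong\mathbb{Z}$ and the strand removals given on $\sigma_1,\sigma_2$ by the formulas above, is not finitely generated. -/

import Mathlib

namespace CohenBraids

/-! ### Removing strands and Cohen braids

`StrandWreath H n` is the permutational wreath product of `H` with the symmetric group on the `n`
strands.  A system of maps "remove the `i`-th strand" `d i : G → H` satisfying
`d i (β * γ) = d i β * d (i·β) γ`, where `i·β` is the position to which the strand starting at
position `i` is moved by `β`, is the same thing as a homomorphism `δ : G →* StrandWreath H n`: the
right component of `δ β` is the permutation of `β` and the `i`-th coordinate of its left component
is `d i β`.  (Braids are read from left to right, so `i·β` is the value at `i` of the inverse of the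
right component.)  Strands are numbered from `0`. -/

/-- The wreath product of `H` with the permutations of `n` strands. -/
abbrev StrandWreath (H : Type) [Group H] (n : ℕ) : Type :=
  (Fin n → H) ⋊[mulAutArrow] Equiv.Perm (Fin n)

theorem wreath_mul_left {H : Type} [Group H] {n : ℕ} (x y : StrandWreath H n) (i : Fin n) :
    (x * y).left i = x.left i * y.left (x.right⁻¹ i) := rfl

theorem wreath_inv_left {H : Type} [Group H] {n : ℕ} (x : StrandWreath H n) (i : Fin n) :
    x⁻¹.left i = (x.left (x.right i))⁻¹ := rfl

section Cohen

variable {G H : Type} [Group G] [Group H] {n : ℕ}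

/-- The permutation of a braid. -/
def perm (δ : G →* StrandWreath H n) : G →* Equiv.Perm (Fin n) :=
  SemidirectProduct.rightHom.comp δ

/-- Removal of the `i`-th strand. -/
def removeStrand (δ : G →* StrandWreath H n) (i : Fin n) (β : G) : H :=
  (δ β).left i

theorem removeStrand_mul (δ : G →* StrandWreath H n) (i : Fin n) (β γ : G) :
    removeStrand δ i (β * γ) =
      removeStrand δ i β * removeStrand δ ((perm δ β)⁻¹ i) γ := by
  simp only [removeStrand, perm, map_mul, wreath_mul_left]
  rfl

theorem removeStrand_one (δ : G →* StrandWreath H n) (i : Fin n) :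
    removeStrand δ i 1 = 1 := by
  simp [removeStrand]

theorem removeStrand_inv (δ : G →* StrandWreath H n) (i : Fin n) (β : G) :
    removeStrand δ i β⁻¹ = (removeStrand δ (perm δ β i) β)⁻¹ := by
  simp only [removeStrand, perm, map_inv, wreath_inv_left]
  rfl

/-- The pure braids: those with trivial permutation. -/
def pureBraids (δ : G →* StrandWreath H n) : Subgroup G :=
  (perm δ).ker

/-- The Cohen braids: those for which the removal of any strand gives the same braid. -/
def cohenBraids (δ : G →* StrandWreath H n) : Subgroup G where
  carrier := {β | ∀ i j : Fin n, removeStrand δ i β = removeStrand δ j β}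
  mul_mem' := by
    intro β γ hβ hγ i j
    rw [removeStrand_mul, removeStrand_mul, hβ i j,
      hγ ((perm δ β)⁻¹ i) ((perm δ β)⁻¹ j)]
  one_mem' := by
    intro i j
    rw [removeStrand_one, removeStrand_one]
  inv_mem' := by
    intro β hβ i j
    rw [removeStrand_inv, removeStrand_inv, hβ (perm δ β i) (perm δ β j)]

/-- The pure Cohen braids. -/
def pureCohenBraids (δ : G →* StrandWreath H n) : Subgroup G :=
  cohenBraids δ ⊓ pureBraids δ

end Cohen

/-- The commutator `[a, b] = a⁻¹ b⁻¹ a b`. -/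
def comm {G : Type} [Group G] (a b : G) : G := a⁻¹ * b⁻¹ * a * b

/-! ### The projective plane -/

namespace RP2

/-- Generators of the braid group of the projective plane on two strands. -/
inductive Gen₂ : Type
  | σ₁ | ρ

/-- Generators of the braid group of the projective plane on three strands. -/
inductive Gen₃ : Type
  | σ₁ | σ₂ | ρ

/-- Defining relators on two strands:
`σ₁⁻¹ ρ σ₁⁻¹ ρ = ρ σ₁⁻¹ ρ σ₁` and `ρ² = σ₁²`. -/
def rels₂ : Set (FreeGroup Gen₂) :=
  let s := FreeGroup.of Gen₂.σ₁
  let r := FreeGroup.of Gen₂.ρ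
  {(s⁻¹ * r * s⁻¹ * r) * (r * s⁻¹ * r * s)⁻¹, r ^ 2 * (s ^ 2)⁻¹}

/-- Defining relators on three strands: `σ₁ σ₂ σ₁ = σ₂ σ₁ σ₂`, `ρ σ₂ = σ₂ ρ`,
`σ₁⁻¹ ρ σ₁⁻¹ ρ = ρ σ₁⁻¹ ρ σ₁` and `ρ² = σ₁ σ₂² σ₁`. -/
def rels₃ : Set (FreeGroup Gen₃) :=
  let s := FreeGroup.of Gen₃.σ₁
  let t := FreeGroup.of Gen₃.σ₂
  let r := FreeGroup.of Gen₃.ρ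
  {(s * t * s) * (t * s * t)⁻¹, (r * t) * (t * r)⁻¹,
    (s⁻¹ * r * s⁻¹ * r) * (r * s⁻¹ * r * s)⁻¹, r ^ 2 * (s * t ^ 2 * s)⁻¹}

/-- The braid group of the projective plane on two strands. -/
abbrev B₂ : Type := PresentedGroup rels₂

/-- The braid group of the projective plane on three strands. -/
abbrev B₃ : Type := PresentedGroup rels₃

theorem B₂_rel₁ :
    ((PresentedGroup.of Gen₂.σ₁)⁻¹ * PresentedGroup.of Gen₂.ρ *
      (PresentedGroup.of Gen₂.σ₁)⁻¹ * PresentedGroup.of Gen₂.ρ : B₂) =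
    PresentedGroup.of Gen₂.ρ * (PresentedGroup.of Gen₂.σ₁)⁻¹ *
      PresentedGroup.of Gen₂.ρ * PresentedGroup.of Gen₂.σ₁ := by
  rw [← mul_inv_eq_one]
  exact PresentedGroup.one_of_mem (rels := rels₂) (Or.inl rfl)

theorem B₂_rel₂ :
    (PresentedGroup.of Gen₂.ρ ^ 2 : B₂) = PresentedGroup.of Gen₂.σ₁ ^ 2 := by
  rw [← mul_inv_eq_one]
  exact PresentedGroup.one_of_mem (rels := rels₂) (Or.inr rfl)

/-- Strand removal and permutation on the generators of `B₃`.  The generator `σ₁` interchanges the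
first two strands, `σ₂` the last two, and `ρ` is the pure braid in which the first strand runs
once around a projective line while the other two strands stay fixed.  Removing one of the two
strands that cross in `σᵢ`, or the moving strand of `ρ`, leaves the trivial braid. -/
def strandsGen : Gen₃ → StrandWreath B₂ 3
  | .σ₁ => ⟨![1, 1, PresentedGroup.of .σ₁], Equiv.swap 0 1⟩
  | .σ₂ => ⟨![PresentedGroup.of .σ₁, 1, 1], Equiv.swap 1 2⟩
  | .ρ => ⟨![1, PresentedGroup.of .ρ, PresentedGroup.of .ρ], 1⟩

theorem strandsGen_rels : ∀ r ∈ rels₃, FreeGroup.lift strandsGen r = 1 := by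
  have h₁ := B₂_rel₁
  have h₂ := B₂_rel₂
  intro r hr
  simp only [rels₃, Set.mem_insert_iff, Set.mem_singleton_iff] at hr
  rcases hr with rfl | rfl | rfl | rfl <;>
  simp only [map_mul, map_inv, map_pow, FreeGroup.lift_apply_of, mul_inv_eq_one] <;>
  refine SemidirectProduct.ext ?_ ?_
  all_goals first
    | (simp only [strandsGen, pow_two, SemidirectProduct.mul_right, SemidirectProduct.inv_right]
       decide)
    | (funext i
       fin_cases i <;>
       simp [strandsGen, pow_two, wreath_mul_left, wreath_inv_left, Equiv.swap_apply_def,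
         -SemidirectProduct.mul_left, -SemidirectProduct.inv_left] <;>
       simp_all [pow_two, mul_assoc])

/-- Strand removal and permutation on `B₃`. -/
def strands : B₃ →* StrandWreath B₂ 3 :=
  PresentedGroup.toGroup strandsGen_rels

/-- The group of pure Cohen braids of the projective plane on three strands. -/
def H₃ : Subgroup B₃ := pureCohenBraids strands

def σ₁ : B₃ := PresentedGroup.of .σ₁

def σ₂ : B₃ := PresentedGroup.of .σ₂

def ρ : B₃ := PresentedGroup.of .ρ

/-- The conjugate of `ρ` in which the second strand moves. -/
def u : B₃ := σ₁ * ρ * σ₁⁻¹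

/-- The conjugate of `ρ` in which the third strand moves. -/
def w : B₃ := σ₂ * σ₁ * ρ * σ₁⁻¹ * σ₂⁻¹

/-- The pure braid in which the last two strands make a full twist. -/
def A₂₃ : B₃ := σ₂ ^ 2

end RP2

/-! ### The disc -/

namespace Disc

/-- Generators of the braid group of the disc on three strands. -/
inductive Gen₃ : Type
  | σ₁ | σ₂

/-- The defining relator of the braid group on three strands: `σ₁ σ₂ σ₁ = σ₂ σ₁ σ₂`. -/
def rels₃ : Set (FreeGroup Gen₃) :=
  let s := FreeGroup.of Gen₃.σ₁
  let t := FreeGroup.of Gen₃.σ₂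
  {(s * t * s) * (t * s * t)⁻¹}

/-- The braid group of the disc on two strands: one generator `σ₁`, no relation. -/
abbrev B₂ : Type := FreeGroup Unit

/-- The braid group of the disc on three strands. -/
abbrev B₃ : Type := PresentedGroup rels₃

/-- Strand removal and permutation on the generators of `B₃`: removing one of the two strands that
cross in `σᵢ` leaves the trivial braid, removing the third strand leaves the crossing `σ₁`. -/
def strandsGen : Gen₃ → StrandWreath B₂ 3
  | .σ₁ => ⟨![1, 1, FreeGroup.of ()], Equiv.swap 0 1⟩
  | .σ₂ => ⟨![FreeGroup.of (), 1, 1], Equiv.swap 1 2⟩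

theorem strandsGen_rels : ∀ r ∈ rels₃, FreeGroup.lift strandsGen r = 1 := by
  intro r hr
  simp only [rels₃, Set.mem_singleton_iff] at hr
  subst hr
  simp only [map_mul, map_inv, FreeGroup.lift_apply_of, mul_inv_eq_one]
  refine SemidirectProduct.ext ?_ ?_
  · funext i
    fin_cases i <;> simp [strandsGen, wreath_mul_left, Equiv.swap_apply_def, -SemidirectProduct.mul_left]
  · simp only [strandsGen, SemidirectProduct.mul_right]
    decide

/-- Strand removal and permutation on `B₃`. -/
def strands : B₃ →* StrandWreath B₂ 3 :=
  PresentedGroup.toGroup strandsGen_rels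

/-- The group of pure Cohen braids of the disc on three strands. -/
def H₃ : Subgroup B₃ := pureCohenBraids strands

end Disc

end CohenBraids

/-!
For the projective plane, let `F` be the subgroup `fibre` of `B₃` generated by `w` and `A₂₃`.
Since `w ^ 2 = σ₂ * σ₁ ^ 2 * σ₂`, this subgroup is normalized by `σ₁` and `ρ`, and the subgroup
generated by `F`, `σ₁` and `ρ` has the three cosets given by `1`, `σ₂`, `σ₂ * σ₁`, permuted like
the strands; so it contains all pure braids (`pure_le_lifts`). Modulo `F`, the braids `σ₁` and `ρ`
satisfy the relations of the two-strand group, a generalized quaternion group of order `16`, and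
the normal form there (`exists_normal_form`) shows that a pure braid is `(ρ * u * w) ^ i * f` or
`(ρ * u * w) ^ i * ρ * f` with `f ∈ F` (`exists_mem_fibre_of_mem_pure`).

The braid `ρ * u * w` is a Cohen braid, so for a pure Cohen braid the factor `f` or `ρ * f` is one
as well. Removing the third strand kills `F`. Hence `ρ * f` is impossible: it would leave `ρ` upon
removal of the third strand, but a power of the image `u₂` of `w` upon removal of the first. In
the other case every strand removal kills `f`. Since `w` and `A₂₃` go to `u₂` and `u₂ ^ 2` when
the first strand is removed, to `u₂` and `1` when the second is, and `u₂` has order `4`, the braid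
`f` lies in the kernel of the map to `ℤ/4 × ℤ/2` that counts `w` and `A₂₃`. The nine remaining
elements generate this kernel, because they generate a subgroup that is normalized by `w` and
`A₂₃`, contains `w ^ 4` and `A₂₃ ^ 2`, and modulo which `w` and `A₂₃` commute
(`exists_mem_closure_kernelGens`).

For the disc, the stabilizer of the third strand is represented by affine bijections of `ℚ` in
such a way that `σ₁ ^ 2` acts by `x ↦ x / 16` and pure Cohen braids act by translations
(`exists_translation`). The conjugates by powers of `σ₁ ^ 2` of a commutator of `σ₁ ^ 2` and
`σ₂ ^ 2` are pure Cohen braids that act by the translations `15 / 16 ^ n`. Their denominators are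
unbounded, so the group of translations obtained, a quotient of the group of pure Cohen braids, is
not finitely generated.
-/

namespace CohenBraids

/-! ### Generalities on groups -/

section Generalities

variable {G : Type} [Group G]

theorem comm_eq_one_of_commute {x y : G} (h : Commute x y) : comm x y = 1 := by
  rw [comm, mul_assoc, h.eq]
  group

theorem map_comm {H : Type} [Group H] (f : G →* H) (x y : G) :
    f (comm x y) = comm (f x) (f y) := by
  simp [comm]

theorem conj_mem_closure {S : Set G} {g x : G}
    (h : ∀ y ∈ S, g * y * g⁻¹ ∈ Subgroup.closure S) (hx : x ∈ Subgroup.closure S) :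
    g * x * g⁻¹ ∈ Subgroup.closure S := by
  have : Subgroup.closure S ≤ (Subgroup.closure S).comap (MulAut.conj g).toMonoidHom :=
    (Subgroup.closure_le _).2 fun y hy => by simpa using h y hy
  simpa using this hx

theorem mem_normalizer_closure {S : Set G} {g : G}
    (h : ∀ x ∈ S, g * x * g⁻¹ ∈ Subgroup.closure S)
    (h' : ∀ x ∈ S, g⁻¹ * x * g ∈ Subgroup.closure S) :
    g ∈ Subgroup.normalizer (Subgroup.closure S : Set G) := by
  rw [Subgroup.mem_normalizer_iff]
  refine fun x => ⟨conj_mem_closure h, fun hx => ?_⟩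
  have := conj_mem_closure (g := g⁻¹) (by simpa using h') hx
  simpa [mul_assoc] using this

/-- Reduction modulo `F` on the normalizer of `F`. -/
abbrev normalizerMk (F : Subgroup G) :=
  QuotientGroup.mk' (F.subgroupOf (Subgroup.normalizer (F : Set G)))

/-- The subgroup of the normalizer of `F` consisting of the elements whose class modulo `F` lies
in the subgroup generated by the classes of `s` and `t`. -/
def saturation (F : Subgroup G) (s t : Subgroup.normalizer (F : Set G)) : Subgroup G :=
  ((Subgroup.closure {normalizerMk F s, normalizerMk F t}).comap (normalizerMk F)).map
    (Subgroup.subtype _)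

theorem mem_saturation {F : Subgroup G} {s t : Subgroup.normalizer (F : Set G)} {x : G} :
    x ∈ saturation F s t ↔ ∃ y : Subgroup.normalizer (F : Set G), (y : G) = x ∧
      normalizerMk F y ∈ Subgroup.closure {normalizerMk F s, normalizerMk F t} := by
  simp only [saturation, Subgroup.mem_map, Subgroup.mem_comap, Subgroup.coe_subtype]
  constructor
  · rintro ⟨y, h, rfl⟩
    exact ⟨y, rfl, h⟩
  · rintro ⟨y, rfl, h⟩
    exact ⟨y, h, rfl⟩

theorem left_mem_saturation {F : Subgroup G} (s t : Subgroup.normalizer (F : Set G)) :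
    (s : G) ∈ saturation F s t :=
  mem_saturation.2 ⟨s, rfl, Subgroup.subset_closure (Or.inl rfl)⟩

theorem right_mem_saturation {F : Subgroup G} (s t : Subgroup.normalizer (F : Set G)) :
    (t : G) ∈ saturation F s t :=
  mem_saturation.2 ⟨t, rfl, Subgroup.subset_closure (Or.inr rfl)⟩

theorem le_saturation {F : Subgroup G} (s t : Subgroup.normalizer (F : Set G)) :
    F ≤ saturation F s t := by
  intro x hx
  refine mem_saturation.2 ⟨⟨x, Subgroup.le_normalizer hx⟩, rfl, ?_⟩
  have : normalizerMk F ⟨x, Subgroup.le_normalizer hx⟩ = 1 :=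
    (QuotientGroup.eq_one_iff _).2 (Subgroup.mem_subgroupOf.2 hx)
  rw [this]
  exact one_mem _

theorem normalizerMk_eq_iff {F : Subgroup G} {x y : Subgroup.normalizer (F : Set G)} :
    normalizerMk F x = normalizerMk F y ↔ (x : G)⁻¹ * y ∈ F := by
  rw [QuotientGroup.mk'_apply, QuotientGroup.mk'_apply, QuotientGroup.eq,
    Subgroup.mem_subgroupOf]
  simp

/-- If the cosets `M * t i` are permuted by the elements of `S` according to a homomorphism `p`,
then they are so by all elements of the subgroup generated by `S`. -/
theorem coset_permutation {ι : Type} (p : G →* Equiv.Perm ι) (M : Subgroup G) (t : ι → G)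
    {S : Set G} (h : ∀ g ∈ S, ∀ i, t i * g * (t ((p g)⁻¹ i))⁻¹ ∈ M) {x : G}
    (hx : x ∈ Subgroup.closure S) (i : ι) : t i * x * (t ((p x)⁻¹ i))⁻¹ ∈ M := by
  induction hx using Subgroup.closure_induction generalizing i with
  | mem g hg => exact h g hg i
  | one => simp
  | mul x y _ _ ihx ihy =>
    have := mul_mem (ihx i) (ihy ((p x)⁻¹ i))
    simpa [mul_assoc] using this
  | inv x _ ih =>
    have := inv_mem (ih (p x i))
    simpa [mul_assoc] using this

theorem exists_zpow_mul_zpow_of_commute {a b x : G} (hab : Commute a b)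
    (hx : x ∈ Subgroup.closure {a, b}) : ∃ i j : ℤ, x = a ^ i * b ^ j := by
  induction hx using Subgroup.closure_induction_left with
  | one => exact ⟨0, 0, by simp⟩
  | mul_left g hg y _ ih =>
    obtain ⟨i, j, rfl⟩ := ih
    rcases hg with rfl | rfl
    · exact ⟨1 + i, j, by rw [zpow_add, zpow_one, mul_assoc]⟩
    · exact ⟨i, 1 + j, by
        rw [zpow_add, zpow_one, ← mul_assoc, ← mul_assoc, (hab.zpow_left i).eq]⟩
  | inv_mul_cancel g hg y _ ih =>
    obtain ⟨i, j, rfl⟩ := ih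
    rcases hg with rfl | rfl
    · exact ⟨-1 + i, j, by rw [zpow_add, zpow_neg_one, mul_assoc]⟩
    · exact ⟨i, -1 + j, by
        rw [zpow_add, zpow_neg_one, ← mul_assoc, ← mul_assoc, ((hab.inv_right).zpow_left i).eq]⟩

/-- The relations of the two-strand braid group of the projective plane, written in terms of `s` and
`a = s⁻¹ * r`, define the generalized quaternion group of order `16`. -/
theorem exists_quaternion_rels {s r : G} (h₁ : s⁻¹ * r * s⁻¹ * r = r * s⁻¹ * r * s)
    (h₂ : r ^ 2 = s ^ 2) :
    ∃ a, r = s * a ∧ (∀ i : ℤ, s * a ^ i = a ^ (-i) * s) ∧ s * s = a ^ (4 : ℤ) ∧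
      a ^ (8 : ℤ) = 1 := by
  obtain ⟨a, rfl⟩ : ∃ a, r = s * a := ⟨s⁻¹ * r, by group⟩
  have h3 : a * s * a = s := by
    have : s * (a * s * a) = s * s := by
      rw [← pow_two s, ← h₂, pow_two]; group
    exact mul_left_cancel this
  have hsa : s * a * s⁻¹ = a⁻¹ := by
    rw [mul_inv_eq_iff_eq_mul, eq_inv_mul_iff_mul_eq, ← mul_assoc, h3]
  have hsai : ∀ i : ℤ, s * a ^ i = a ^ (-i) * s := by
    intro i
    rw [← mul_inv_eq_iff_eq_mul, ← conj_zpow, hsa, inv_zpow, zpow_neg]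
  have has : a * s = s * a⁻¹ := by
    have := hsai (-1)
    rwa [neg_neg, zpow_one, zpow_neg_one, eq_comm] at this
  have hs2 : s * s = a ^ (4 : ℤ) := by
    have h4 : a * a = s * s * a⁻¹ * a⁻¹ := by
      have e : s⁻¹ * (s * a) * s⁻¹ * (s * a) = a * a := by group
      rw [← e, h₁]
      calc s * a * s⁻¹ * (s * a) * s = s * a * (a * s) := by group
        _ = s * a * (s * a⁻¹) := by rw [has]
        _ = s * (a * s) * a⁻¹ := by simp only [mul_assoc]
        _ = s * s * a⁻¹ * a⁻¹ := by rw [has]; simp only [mul_assoc]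
    calc s * s = s * s * a⁻¹ * a⁻¹ * (a * a) := by group
      _ = a ^ (4 : ℤ) := by
        rw [← h4, zpow_ofNat]
        simp only [pow_succ, pow_zero, one_mul, mul_assoc]
  have ha8 : a ^ (8 : ℤ) = 1 := by
    have h5 : a ^ (4 : ℤ) = a ^ (-4 : ℤ) := by
      refine mul_right_cancel (b := s) ?_
      rw [← hsai, ← hs2, mul_assoc]
    rw [show (8 : ℤ) = 4 + 4 by norm_num, zpow_add]
    nth_rewrite 1 [h5]
    group
  exact ⟨a, rfl, hsai, hs2, ha8⟩

/-- Normal forms in a group with two generators that satisfy the relations of the two-strand braid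
group of the projective plane: every element is `a ^ i` or `a ^ i * s` with `a = s⁻¹ * r`, and
`r * s * r * s⁻¹ = a ^ 2`. -/
theorem exists_normal_form {s r x : G} (h₁ : s⁻¹ * r * s⁻¹ * r = r * s⁻¹ * r * s)
    (h₂ : r ^ 2 = s ^ 2) (hx : x ∈ Subgroup.closure {s, r}) :
    ∃ i : ℤ, x = (r * s * r * s⁻¹) ^ i ∨ x = (r * s * r * s⁻¹) ^ i * r ∨
      x = (r * s * r * s⁻¹) ^ i * s ∨ x = (r * s * r * s⁻¹) ^ i * (r * s) := by
  obtain ⟨a, rfl, hsai, hs2, ha8⟩ := exists_quaternion_rels h₁ h₂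
  have has : a * s = s * a⁻¹ := by
    have := hsai (-1)
    rwa [neg_neg, zpow_one, zpow_neg_one, eq_comm] at this
  have hc : s * a * s * (s * a) * s⁻¹ = a ^ (2 : ℤ) := by
    calc s * a * s * (s * a) * s⁻¹ = s * (a * (s * s) * a) * s⁻¹ := by group
      _ = s * a ^ (6 : ℤ) * s⁻¹ := by rw [hs2]; group
      _ = a ^ (-6 : ℤ) * a ^ (8 : ℤ) := by rw [hsai, ha8]; group
      _ = a ^ (2 : ℤ) := by group
  have hsinv : s⁻¹ = a ^ (-4 : ℤ) * s := by
    rw [inv_eq_iff_mul_eq_one, ← mul_assoc, hsai, mul_assoc, hs2]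
    group
    exact ha8
  rw [hc]
  -- Every element is a power of `a` or a power of `a` times `s`.
  have key : ∃ i : ℤ, x = a ^ i ∨ x = a ^ i * s := by
    have mul_s : ∀ y : G, (∃ i : ℤ, y = a ^ i ∨ y = a ^ i * s) →
        ∃ i : ℤ, s * y = a ^ i ∨ s * y = a ^ i * s := by
      rintro y ⟨i, rfl | rfl⟩
      · exact ⟨-i, Or.inr (hsai i)⟩
      · exact ⟨-i + 4, Or.inl (by rw [← mul_assoc, hsai, mul_assoc, hs2, zpow_add])⟩
    have mul_a : ∀ (k : ℤ) (y : G), (∃ i : ℤ, y = a ^ i ∨ y = a ^ i * s) →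
        ∃ i : ℤ, a ^ k * y = a ^ i ∨ a ^ k * y = a ^ i * s := by
      rintro k y ⟨i, rfl | rfl⟩
      · exact ⟨k + i, Or.inl (zpow_add a k i).symm⟩
      · exact ⟨k + i, Or.inr (by rw [zpow_add, mul_assoc])⟩
    induction hx using Subgroup.closure_induction_left with
    | one => exact ⟨0, Or.inl (by simp)⟩
    | mul_left g hg y _ ih =>
      rcases hg with rfl | rfl
      · exact mul_s y ih
      · simpa [mul_assoc] using mul_s _ (mul_a 1 y ih)
    | inv_mul_cancel g hg y _ ih =>
      have inv_s : ∀ z : G, (∃ i : ℤ, z = a ^ i ∨ z = a ^ i * s) →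
          ∃ i : ℤ, s⁻¹ * z = a ^ i ∨ s⁻¹ * z = a ^ i * s := by
        intro z hz
        simpa [hsinv, mul_assoc] using mul_a (-4) _ (mul_s z hz)
      rcases hg with rfl | rfl
      · exact inv_s y ih
      · simpa [mul_assoc] using mul_a (-1) _ (inv_s y ih)
  obtain ⟨i, hi⟩ := key
  obtain ⟨k, rfl | rfl⟩ := Int.even_or_odd' i
  · rw [zpow_mul] at hi
    exact ⟨k, by tauto⟩
  · rcases hi with h | h
    · refine ⟨k - 1, Or.inr (Or.inr (Or.inr ?_))⟩
      rw [h, show s * a * s = a ^ (3 : ℤ) by rw [mul_assoc, has, ← mul_assoc, hs2]; group,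
        ← zpow_mul, ← zpow_add]
      congr 1
      ring
    · refine ⟨k + 1, Or.inr (Or.inl ?_)⟩
      rw [h, show s * a = a ^ (-1 : ℤ) * s by simpa using hsai 1, ← zpow_mul, ← mul_assoc,
        ← zpow_add]
      congr 2
      ring

end Generalities

/-! ### Strand removal on pure braids -/

/-- Removal of the `i`-th strand as a homomorphism on pure braids. -/
def removePure {G H : Type} [Group G] [Group H] {n : ℕ} (δ : G →* StrandWreath H n) (i : Fin n) :
    pureBraids δ →* H where
  toFun β := removeStrand δ i β
  map_one' := removeStrand_one δ i
  map_mul' β γ := by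
    have h : perm δ β = 1 := β.2
    simp [removeStrand_mul, h]

theorem mem_pureCohenBraids {G H : Type} [Group G] [Group H] {n : ℕ} {δ : G →* StrandWreath H n}
    {β : G} : β ∈ pureCohenBraids δ ↔ ∃ h : β ∈ pureBraids δ,
      ∀ i j, removePure δ i ⟨β, h⟩ = removePure δ j ⟨β, h⟩ :=
  ⟨fun h => ⟨h.2, h.1⟩, fun ⟨h, h'⟩ => ⟨h', h⟩⟩

namespace RP2

/-! ### Relations between braids of the projective plane -/

theorem braid_rel : σ₁ * σ₂ * σ₁ = σ₂ * σ₁ * σ₂ := by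
  rw [← mul_inv_eq_one]
  exact PresentedGroup.one_of_mem (rels := rels₃) (Or.inl rfl)

theorem ρ_comm_σ₂ : ρ * σ₂ = σ₂ * ρ := by
  rw [← mul_inv_eq_one]
  exact PresentedGroup.one_of_mem (rels := rels₃) (Or.inr (Or.inl rfl))

theorem σ₁_ρ_rel : σ₁⁻¹ * ρ * σ₁⁻¹ * ρ = ρ * σ₁⁻¹ * ρ * σ₁ := by
  rw [← mul_inv_eq_one]
  exact PresentedGroup.one_of_mem (rels := rels₃) (Or.inr (Or.inr (Or.inl rfl)))

theorem ρ_sq : ρ ^ 2 = σ₁ * σ₂ ^ 2 * σ₁ := by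
  rw [← mul_inv_eq_one]
  exact PresentedGroup.one_of_mem (rels := rels₃) (Or.inr (Or.inr (Or.inr rfl)))

theorem w_sq : w ^ 2 = σ₂ * σ₁ ^ 2 * σ₂ := by
  calc w ^ 2 = σ₂ * σ₁ * ρ ^ 2 * σ₁⁻¹ * σ₂⁻¹ := by simp only [w, pow_two]; group
    _ = σ₂ * σ₁ ^ 2 * σ₂ := by rw [ρ_sq]; simp only [pow_two]; group

theorem σ₁_comm_w : σ₁ * w = w * σ₁ := by
  have e : σ₂ * σ₁⁻¹ * σ₂⁻¹ = σ₁⁻¹ * σ₂⁻¹ * σ₁ := by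
    calc σ₂ * σ₁⁻¹ * σ₂⁻¹ = σ₁⁻¹ * σ₂⁻¹ * (σ₂ * σ₁ * σ₂) * σ₁⁻¹ * σ₂⁻¹ := by group
      _ = σ₁⁻¹ * σ₂⁻¹ * σ₁ := by rw [← braid_rel]; group
  calc σ₁ * w = σ₁ * σ₂ * σ₁ * ρ * σ₁⁻¹ * σ₂⁻¹ := by simp only [w]; group
    _ = σ₂ * σ₁ * (ρ * σ₂) * σ₁⁻¹ * σ₂⁻¹ := by rw [braid_rel, ρ_comm_σ₂]; group
    _ = σ₂ * σ₁ * ρ * (σ₂ * σ₁⁻¹ * σ₂⁻¹) := by group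
    _ = w * σ₁ := by rw [e]; simp only [w]; group

theorem ρ_comm_A₂₃ : ρ * A₂₃ = A₂₃ * ρ := by
  have : Commute ρ σ₂ := ρ_comm_σ₂
  exact this.pow_right 2

theorem σ₁_inv_conj_A₂₃ : σ₁⁻¹ * A₂₃ * σ₁ = w ^ 2 * A₂₃⁻¹ := by
  rw [eq_mul_inv_iff_mul_eq, w_sq]
  calc σ₁⁻¹ * A₂₃ * σ₁ * A₂₃ = σ₁⁻¹ * σ₂ * (σ₂ * σ₁ * σ₂) * σ₂ := by
        simp only [A₂₃, pow_two]; group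
    _ = σ₁⁻¹ * σ₂ * (σ₁ * σ₂ * σ₁) * σ₂ := by rw [braid_rel]
    _ = σ₁⁻¹ * (σ₂ * σ₁ * σ₂) * σ₁ * σ₂ := by group
    _ = σ₁⁻¹ * (σ₁ * σ₂ * σ₁) * σ₁ * σ₂ := by rw [braid_rel]
    _ = σ₂ * σ₁ ^ 2 * σ₂ := by simp only [pow_two]; group

theorem σ₁_conj_A₂₃ : σ₁ * A₂₃ * σ₁⁻¹ = A₂₃⁻¹ * w ^ 2 := by
  have h : Commute σ₁ (w ^ 2) := Commute.pow_right σ₁_comm_w 2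
  calc σ₁ * A₂₃ * σ₁⁻¹ = A₂₃⁻¹ * (σ₁ * (σ₁⁻¹ * A₂₃ * σ₁) * A₂₃ * σ₁⁻¹) := by group
    _ = A₂₃⁻¹ * (σ₁ * w ^ 2 * σ₁⁻¹) := by rw [σ₁_inv_conj_A₂₃]; group
    _ = A₂₃⁻¹ * w ^ 2 := by rw [h.eq]; group

/-- An expression in `w` and `A₂₃` of the pure braid in which the first and the third strand make a
full twist. -/
theorem σ₂_conj_σ₁_sq : σ₂ * σ₁ ^ 2 * σ₂⁻¹ = w ^ 2 * A₂₃⁻¹ := by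
  rw [w_sq]; simp only [A₂₃, pow_two]; group

theorem ρ_conj_w : ρ * w * ρ⁻¹ = w⁻¹ * A₂₃ := by
  -- The relation between `σ₁` and `ρ` describes the conjugate by `ρ` of `σ₁⁻¹ * ρ * σ₁`;
  -- conjugation by `σ₂`, which commutes with `ρ`, turns this braid into `A₂₃ * w * A₂₃⁻¹`.
  have h₁ : ρ * (σ₁⁻¹ * ρ * σ₁) * ρ⁻¹ = σ₁⁻¹ * ρ * σ₁ * (σ₁ ^ 2)⁻¹ := by
    calc ρ * (σ₁⁻¹ * ρ * σ₁) * ρ⁻¹ = ρ * σ₁⁻¹ * ρ * σ₁ * ρ⁻¹ := by group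
      _ = σ₁⁻¹ * ρ * σ₁ * (σ₁ ^ 2)⁻¹ := by rw [← σ₁_ρ_rel]; simp only [pow_two]; group
  have h₂ : σ₂ * (σ₁⁻¹ * ρ * σ₁) * σ₂⁻¹ = A₂₃ * w * A₂₃⁻¹ := by
    calc σ₂ * (σ₁⁻¹ * ρ * σ₁) * σ₂⁻¹
        = (σ₂ * σ₁ ^ 2 * σ₂⁻¹)⁻¹ * w * (σ₂ * σ₁ ^ 2 * σ₂⁻¹) := by
          simp only [w, pow_two]; group
      _ = A₂₃ * w * A₂₃⁻¹ := by rw [σ₂_conj_σ₁_sq]; group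
  have hA : ρ * A₂₃⁻¹ = A₂₃⁻¹ * ρ := (Commute.inv_right ρ_comm_A₂₃ : Commute ρ A₂₃⁻¹)
  have hA' : ρ⁻¹ * A₂₃ = A₂₃ * ρ⁻¹ := (Commute.inv_left ρ_comm_A₂₃ : Commute ρ⁻¹ A₂₃)
  have h2' : ρ * σ₂ * ρ⁻¹ = σ₂ := by rw [ρ_comm_σ₂]; group
  calc ρ * w * ρ⁻¹ = (ρ * A₂₃⁻¹) * (A₂₃ * w * A₂₃⁻¹) * (A₂₃ * ρ⁻¹) := by group
    _ = A₂₃⁻¹ * (ρ * (A₂₃ * w * A₂₃⁻¹) * ρ⁻¹) * A₂₃ := by rw [hA, ← hA']; group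
    _ = A₂₃⁻¹ * ((ρ * σ₂ * ρ⁻¹) * (ρ * (σ₁⁻¹ * ρ * σ₁) * ρ⁻¹) * (ρ * σ₂ * ρ⁻¹)⁻¹) * A₂₃ := by
      rw [← h₂]; group
    _ = A₂₃⁻¹ * ((σ₂ * (σ₁⁻¹ * ρ * σ₁) * σ₂⁻¹) * (σ₂ * σ₁ ^ 2 * σ₂⁻¹)⁻¹) * A₂₃ := by
      rw [h2', h₁]; group
    _ = w⁻¹ * A₂₃ := by rw [h₂, σ₂_conj_σ₁_sq]; group

theorem ρ_inv_conj_w : ρ⁻¹ * w * ρ = A₂₃ * w⁻¹ := by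
  have h : ρ * (A₂₃ * w⁻¹) * ρ⁻¹ = w := by
    calc ρ * (A₂₃ * w⁻¹) * ρ⁻¹ = (ρ * A₂₃) * ρ⁻¹ * (ρ * w * ρ⁻¹)⁻¹ := by group
      _ = w := by rw [ρ_comm_A₂₃, ρ_conj_w]; group
  calc ρ⁻¹ * w * ρ = ρ⁻¹ * (ρ * (A₂₃ * w⁻¹) * ρ⁻¹) * ρ := by rw [h]
    _ = A₂₃ * w⁻¹ := by group

/-! ### The fibre of the removal of the third strand -/

/-- The subgroup generated by `w` and `A₂₃`, which turns out to consist of the pure braids that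
become trivial when the third strand is removed. -/
def fibre : Subgroup B₃ := Subgroup.closure {w, A₂₃}

theorem w_mem_fibre : w ∈ fibre := Subgroup.subset_closure (Or.inl rfl)

theorem A₂₃_mem_fibre : A₂₃ ∈ fibre := Subgroup.subset_closure (Or.inr rfl)

theorem σ₁_mem_normalizer : σ₁ ∈ Subgroup.normalizer (fibre : Set B₃) := by
  refine mem_normalizer_closure ?_ ?_
  · rintro x (rfl | rfl)
    · rw [σ₁_comm_w, mul_inv_cancel_right]
      exact w_mem_fibre
    · rw [σ₁_conj_A₂₃]
      exact mul_mem (inv_mem A₂₃_mem_fibre) (pow_mem w_mem_fibre 2)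
  · rintro x (rfl | rfl)
    · rw [mul_assoc, ← σ₁_comm_w, inv_mul_cancel_left]
      exact w_mem_fibre
    · rw [σ₁_inv_conj_A₂₃]
      exact mul_mem (pow_mem w_mem_fibre 2) (inv_mem A₂₃_mem_fibre)

theorem ρ_mem_normalizer : ρ ∈ Subgroup.normalizer (fibre : Set B₃) := by
  refine mem_normalizer_closure ?_ ?_
  · rintro x (rfl | rfl)
    · rw [ρ_conj_w]
      exact mul_mem (inv_mem w_mem_fibre) A₂₃_mem_fibre
    · rw [ρ_comm_A₂₃, mul_inv_cancel_right]
      exact A₂₃_mem_fibre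
  · rintro x (rfl | rfl)
    · rw [ρ_inv_conj_w]
      exact mul_mem A₂₃_mem_fibre (inv_mem w_mem_fibre)
    · rw [mul_assoc, ← ρ_comm_A₂₃, inv_mul_cancel_left]
      exact A₂₃_mem_fibre

/-- The braids that are, modulo the fibre, words in `σ₁` and `ρ`. -/
def lifts : Subgroup B₃ :=
  saturation fibre ⟨σ₁, σ₁_mem_normalizer⟩ ⟨ρ, ρ_mem_normalizer⟩

theorem σ₁_mem_lifts : σ₁ ∈ lifts := left_mem_saturation _ _

theorem ρ_mem_lifts : ρ ∈ lifts := right_mem_saturation _ _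

theorem fibre_le_lifts : fibre ≤ lifts := le_saturation _ _

theorem perm_σ₁ : perm strands σ₁ = Equiv.swap 0 1 := rfl

theorem perm_σ₂ : perm strands σ₂ = Equiv.swap 1 2 := rfl

theorem perm_ρ : perm strands ρ = 1 := rfl

theorem closure_generators : Subgroup.closure {σ₁, σ₂, ρ} = (⊤ : Subgroup B₃) := by
  rw [eq_top_iff, ← PresentedGroup.closure_range_of]
  refine Subgroup.closure_mono ?_
  rintro _ ⟨g, rfl⟩
  cases g
  · exact Or.inl rfl
  · exact Or.inr (Or.inl rfl)
  · exact Or.inr (Or.inr rfl)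

/-- A pure braid lies in `lifts`, because the three cosets of `lifts` given by `σ₂ * σ₁`, `σ₂` and
`1` are permuted like the strands. -/
theorem pure_le_lifts : pureBraids strands ≤ lifts := by
  intro β hβ
  have hβ' : perm strands β = 1 := hβ
  have := coset_permutation (perm strands) lifts ![σ₂ * σ₁, σ₂, 1] (S := {σ₁, σ₂, ρ}) ?_
    (x := β) (by rw [closure_generators]; trivial) 2
  · simpa [hβ'] using this
  · rintro g (rfl | rfl | rfl) i
    · rw [perm_σ₁]
      fin_cases i
      · have h := fibre_le_lifts (mul_mem (pow_mem w_mem_fibre 2) (inv_mem A₂₃_mem_fibre))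
        rw [← σ₂_conj_σ₁_sq] at h
        simpa [pow_two, mul_assoc] using h
      · simp
      · simpa [Equiv.swap_apply_def] using σ₁_mem_lifts
    · rw [perm_σ₂]
      fin_cases i
      · have h : σ₂ * σ₁ * σ₂ * (σ₂ * σ₁)⁻¹ = σ₁ := by rw [← braid_rel]; group
        simpa [Equiv.swap_apply_def, h, -mul_inv_rev] using σ₁_mem_lifts
      · simpa [A₂₃, pow_two] using fibre_le_lifts A₂₃_mem_fibre
      · simp
    · rw [perm_ρ]
      fin_cases i
      · simpa [w, mul_assoc] using fibre_le_lifts w_mem_fibre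
      · simpa [← ρ_comm_σ₂] using ρ_mem_lifts
      · simpa using ρ_mem_lifts

end RP2

/-! ### The kernel of a homomorphism onto `ℤ/4 × ℤ/2` -/

section Kernel

variable {G : Type} [Group G]

/-- If a positive power of `g` lies in the subgroup generated by `S`, then conjugation of `S` by `g`
need only be checked in one direction. -/
theorem mem_normalizer_closure_of_pow {S : Set G} {g : G} {n : ℕ}
    (hg : g ^ (n + 1) ∈ Subgroup.closure S)
    (h : ∀ x ∈ S, g⁻¹ * x * g ∈ Subgroup.closure S) :
    g ∈ Subgroup.normalizer (Subgroup.closure S : Set G) := by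
  have hinv : ∀ x ∈ Subgroup.closure S, g⁻¹ * x * g ∈ Subgroup.closure S := by
    intro x hx
    simpa using conj_mem_closure (g := g⁻¹) (by simpa using h) hx
  have hpow : ∀ (k : ℕ), ∀ x ∈ Subgroup.closure S, (g ^ k)⁻¹ * x * g ^ k ∈ Subgroup.closure S := by
    intro k
    induction k with
    | zero => intro x hx; simpa using hx
    | succ k ih =>
      intro x hx
      have := hinv _ (ih x hx)
      simpa [pow_succ, mul_assoc] using this
  refine mem_normalizer_closure (fun x hx => ?_) h
  have := mul_mem (mul_mem hg (hpow n x (Subgroup.subset_closure hx))) (inv_mem hg)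
  simpa [pow_succ', mul_assoc] using this

/-- Generators of the kernel of the homomorphism from the free group on `w` and `a` to
`ℤ/4 × ℤ/2` that sends `w` to `(1, 0)` and `a` to `(0, 1)`, taken in a group `G`. -/
def kernelGens (w a : G) : Set G :=
  {w ^ 4, a ^ 2, comm (w ^ 4) a, comm a w, comm a (w ^ 2), comm a (w ^ 3),
    comm (comm a w) a, comm (comm a (w ^ 2)) a, comm (comm a (w ^ 3)) a}

theorem image_kernelGens {H : Type} [Group H] (f : G →* H) (w a : G) :
    f '' kernelGens w a = kernelGens (f w) (f a) := by
  simp [kernelGens, Set.image_insert_eq, comm]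

theorem closure_kernelGens_le_ker {H : Type} [Group H] {f : G →* H} {w a : G}
    (hwa : Commute (f w) (f a)) (hw : f w ^ 4 = 1) (ha : f a ^ 2 = 1) :
    Subgroup.closure (kernelGens w a) ≤ f.ker := by
  have hk : kernelGens (f w) (f a) ⊆ {1} := by
    intro x hx
    simp only [kernelGens, Set.mem_insert_iff, Set.mem_singleton_iff] at hx
    rcases hx with rfl | rfl | rfl | rfl | rfl | rfl | rfl | rfl | rfl <;>
    simp [hw, ha, comm_eq_one_of_commute hwa.symm,
      comm_eq_one_of_commute (hwa.symm.pow_right _), comm_eq_one_of_commute (Commute.one_left _)]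
  rw [Subgroup.closure_le]
  intro x hx
  have : f x ∈ kernelGens (f w) (f a) := image_kernelGens f w a ▸ Set.mem_image_of_mem f hx
  exact hk this

variable {w a : G}

theorem right_mem_normalizer_kernelGens :
    a ∈ Subgroup.normalizer (Subgroup.closure (kernelGens w a) : Set G) := by
  have hmem : ∀ {x}, x ∈ kernelGens w a → x ∈ Subgroup.closure (kernelGens w a) :=
    fun h => Subgroup.subset_closure h
  have ha : a ^ 2 ∈ Subgroup.closure (kernelGens w a) := hmem (by simp [kernelGens])
  have h₁ : ∀ x ∈ Subgroup.closure (kernelGens w a), comm x a ∈ Subgroup.closure (kernelGens w a) →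
      a⁻¹ * x * a ∈ Subgroup.closure (kernelGens w a) := by
    intro x hx hxa
    have e : a⁻¹ * x * a = x * comm x a := by simp only [comm]; group
    rw [e]
    exact mul_mem hx hxa
  have h₂ : ∀ x ∈ Subgroup.closure (kernelGens w a), comm x a ∈ Subgroup.closure (kernelGens w a) →
      a⁻¹ * comm x a * a ∈ Subgroup.closure (kernelGens w a) := by
    intro x hx hxa
    have e : a⁻¹ * comm x a * a = (a⁻¹ * x * a)⁻¹ * ((a ^ 2)⁻¹ * x * a ^ 2) := by
      simp only [comm, pow_two]; group
    rw [e]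
    exact mul_mem (inv_mem (h₁ x hx hxa)) (mul_mem (mul_mem (inv_mem ha) hx) ha)
  refine mem_normalizer_closure_of_pow (n := 1) ha ?_
  intro x hx
  have hx' := hx
  simp only [kernelGens, Set.mem_insert_iff, Set.mem_singleton_iff] at hx'
  rcases hx' with rfl | rfl | rfl | rfl | rfl | rfl | rfl | rfl | rfl
  · exact h₁ _ (hmem hx) (hmem (by simp [kernelGens]))
  · have e : a⁻¹ * a ^ 2 * a = a ^ 2 := by group
    rwa [e]
  · exact h₂ _ (hmem (by simp [kernelGens])) (hmem hx)
  · exact h₁ _ (hmem hx) (hmem (by simp [kernelGens]))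
  · exact h₁ _ (hmem hx) (hmem (by simp [kernelGens]))
  · exact h₁ _ (hmem hx) (hmem (by simp [kernelGens]))
  · exact h₂ _ (hmem (by simp [kernelGens])) (hmem hx)
  · exact h₂ _ (hmem (by simp [kernelGens])) (hmem hx)
  · exact h₂ _ (hmem (by simp [kernelGens])) (hmem hx)

theorem left_mem_normalizer_kernelGens :
    w ∈ Subgroup.normalizer (Subgroup.closure (kernelGens w a) : Set G) := by
  have hmem : ∀ {x}, x ∈ kernelGens w a → x ∈ Subgroup.closure (kernelGens w a) :=
    fun h => Subgroup.subset_closure h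
  have hw : w ^ 4 ∈ Subgroup.closure (kernelGens w a) := hmem (by simp [kernelGens])
  have ha : a ^ 2 ∈ Subgroup.closure (kernelGens w a) := hmem (by simp [kernelGens])
  have hc : comm a w ∈ Subgroup.closure (kernelGens w a) := hmem (by simp [kernelGens])
  have hconj : ∀ x ∈ Subgroup.closure (kernelGens w a),
      a⁻¹ * x * a ∈ Subgroup.closure (kernelGens w a) := by
    intro x hx
    simpa using (Subgroup.mem_normalizer_iff.1
      (inv_mem (right_mem_normalizer_kernelGens (w := w) (a := a))) x).1 hx
  have hc₄ : comm a (w ^ 4) ∈ Subgroup.closure (kernelGens w a) := by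
    have e : comm a (w ^ 4) = (comm (w ^ 4) a)⁻¹ := by simp only [comm]; group
    rw [e]
    exact inv_mem (hmem (by simp [kernelGens]))
  have h₁ : ∀ i : ℕ, comm a (w ^ (i + 1)) ∈ Subgroup.closure (kernelGens w a) →
      w⁻¹ * comm a (w ^ i) * w ∈ Subgroup.closure (kernelGens w a) := by
    intro i hi
    have e : w⁻¹ * comm a (w ^ i) * w = (comm a w)⁻¹ * comm a (w ^ (i + 1)) := by
      simp only [comm, pow_succ]; group
    rw [e]
    exact mul_mem (inv_mem hc) hi
  have h₂ : ∀ x : G, w⁻¹ * x * w ∈ Subgroup.closure (kernelGens w a) →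
      w⁻¹ * comm x a * w ∈ Subgroup.closure (kernelGens w a) := by
    intro x hx
    have e : w⁻¹ * comm x a * w = (w⁻¹ * x * w)⁻¹ * (comm a w)⁻¹ * (a⁻¹ * (w⁻¹ * x * w) * a) *
        comm a w := by
      simp only [comm]; group
    rw [e]
    exact mul_mem (mul_mem (mul_mem (inv_mem hx) (inv_mem hc)) (hconj _ hx)) hc
  have hw₁ : w⁻¹ * comm a w * w ∈ Subgroup.closure (kernelGens w a) := by
    simpa using h₁ 1 (hmem (by simp [kernelGens]))
  have hw₂ := h₁ 2 (hmem (by simp [kernelGens]))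
  have hw₃ := h₁ 3 hc₄
  have hw₄ : w⁻¹ * w ^ 4 * w ∈ Subgroup.closure (kernelGens w a) := by
    have e : w⁻¹ * w ^ 4 * w = w ^ 4 := by group
    rwa [e]
  refine mem_normalizer_closure_of_pow (n := 3) hw ?_
  intro x hx
  simp only [kernelGens, Set.mem_insert_iff, Set.mem_singleton_iff] at hx
  rcases hx with rfl | rfl | rfl | rfl | rfl | rfl | rfl | rfl | rfl
  · exact hw₄
  · have e : w⁻¹ * a ^ 2 * w = a ^ 2 * (a⁻¹ * comm a w * a) * comm a w := by
      simp only [comm, pow_two]; group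
    rw [e]
    exact mul_mem (mul_mem ha (hconj _ hc)) hc
  · exact h₂ _ hw₄
  · exact hw₁
  · exact hw₂
  · exact hw₃
  · exact h₂ _ hw₁
  · exact h₂ _ hw₂
  · exact h₂ _ hw₃

/-- The subgroup generated by `kernelGens w a` is normalized by `w` and `a`, which commute modulo
it. -/
theorem exists_mem_closure_kernelGens {x : G} (hx : x ∈ Subgroup.closure {w, a}) :
    ∃ (i j : ℤ), ∃ k ∈ Subgroup.closure (kernelGens w a), x = w ^ i * a ^ j * k := by
  set K := Subgroup.closure (kernelGens w a) with hK
  let w' : Subgroup.normalizer (K : Set G) := ⟨w, left_mem_normalizer_kernelGens⟩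
  let a' : Subgroup.normalizer (K : Set G) := ⟨a, right_mem_normalizer_kernelGens⟩
  have hle : Subgroup.closure {w, a} ≤ saturation K w' a' := by
    rw [Subgroup.closure_le]
    rintro y (rfl | rfl)
    · exact left_mem_saturation w' a'
    · exact right_mem_saturation w' a'
  obtain ⟨y, rfl, hy⟩ := mem_saturation.1 (hle hx)
  have hcomm : Commute (normalizerMk K w')
      (normalizerMk K a') := by
    rw [Commute, SemiconjBy, ← map_mul, ← map_mul, eq_comm, normalizerMk_eq_iff]
    have : comm w a ∈ K := by
      have e : comm w a = (comm a w)⁻¹ := by simp only [comm]; group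
      rw [e]
      exact inv_mem (Subgroup.subset_closure (by simp [kernelGens]))
    simpa [comm, w', a', mul_assoc] using this
  obtain ⟨i, j, hij⟩ := exists_zpow_mul_zpow_of_commute hcomm hy
  rw [← map_zpow, ← map_zpow, ← map_mul, eq_comm, normalizerMk_eq_iff] at hij
  exact ⟨i, j, _, hij, by simp [w', a', mul_assoc]⟩

end Kernel

namespace RP2

/-! ### The braid group on two strands -/

/-- The generator `σ₁` of the two-strand braid group. -/
def τ : B₂ := PresentedGroup.of .σ₁

/-- The generator `ρ` of the two-strand braid group. -/
def ρ₂ : B₂ := PresentedGroup.of .ρ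

/-- The conjugate of `ρ₂` in which the second strand moves. -/
def u₂ : B₂ := τ * ρ₂ * τ⁻¹

theorem ρ₂_sq : ρ₂ ^ 2 = τ ^ 2 := B₂_rel₂

theorem u₂_sq : u₂ ^ 2 = τ ^ 2 := by
  calc u₂ ^ 2 = τ * ρ₂ ^ 2 * τ⁻¹ := by simp only [u₂, pow_two]; group
    _ = τ ^ 2 := by rw [ρ₂_sq]; group

theorem τ_pow_four : τ ^ 4 = 1 := by
  obtain ⟨a, -, -, h, h'⟩ := exists_quaternion_rels (s := τ) (r := ρ₂) B₂_rel₁ ρ₂_sq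
  rw [show τ ^ 4 = τ * τ * (τ * τ) by simp only [pow_succ, pow_zero, one_mul, mul_assoc], h,
    ← zpow_add]
  exact h'

/-- The representation of the two-strand braid group in the generalized quaternion group of
order `16`. -/
def toQuaternion : B₂ →* QuaternionGroup 4 :=
  PresentedGroup.toGroup (f := fun g => match g with
    | .σ₁ => QuaternionGroup.xa 0
    | .ρ => QuaternionGroup.xa 1) (by
      intro r hr
      simp only [rels₂, Set.mem_insert_iff, Set.mem_singleton_iff] at hr
      rcases hr with rfl | rfl <;>
      simp only [map_mul, map_inv, map_pow, FreeGroup.lift_apply_of] <;> decide)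

theorem toQuaternion_τ : toQuaternion τ = QuaternionGroup.xa 0 := rfl

theorem toQuaternion_ρ₂ : toQuaternion ρ₂ = QuaternionGroup.xa 1 := rfl

theorem toQuaternion_u₂ : toQuaternion u₂ = QuaternionGroup.xa (-1) := by
  rw [u₂, map_mul, map_mul, map_inv, toQuaternion_τ, toQuaternion_ρ₂]
  decide

theorem dvd_of_u₂_zpow_eq_one {i : ℤ} (h : u₂ ^ i = 1) : (4 : ℤ) ∣ i := by
  have h' : (QuaternionGroup.xa (-1) : QuaternionGroup 4) ^ i = 1 := by
    rw [← toQuaternion_u₂, ← map_zpow, h, map_one]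
  rw [← orderOf_dvd_iff_zpow_eq_one, QuaternionGroup.orderOf_xa] at h'
  exact_mod_cast h'

theorem ρ₂_notMem_zpowers_u₂ : ρ₂ ∉ Subgroup.zpowers u₂ := by
  -- The images of `ρ₂` and `u₂` in the quaternion group do not commute.
  rintro ⟨i, hi⟩
  have h : ρ₂ * u₂ = u₂ * ρ₂ := by
    rw [← hi]
    exact ((Commute.refl u₂).zpow_left i).eq
  have h' := congrArg toQuaternion h
  rw [map_mul, map_mul, toQuaternion_u₂, toQuaternion_ρ₂] at h'
  revert h'
  decide

/-! ### Strand removal on the generators of the fibre -/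

theorem ρ_mem_pure : ρ ∈ pureBraids strands := perm_ρ

theorem u_mem_pure : u ∈ pureBraids strands := by
  change perm strands u = 1
  rw [u, map_mul, map_mul, map_inv, perm_ρ, perm_σ₁]
  decide

theorem w_mem_pure : w ∈ pureBraids strands := by
  change perm strands w = 1
  simp only [w, map_mul, map_inv, perm_ρ, perm_σ₁, perm_σ₂]
  decide

theorem A₂₃_mem_pure : A₂₃ ∈ pureBraids strands := by
  change perm strands A₂₃ = 1
  rw [A₂₃, map_pow, perm_σ₂]
  decide

theorem removeStrand_σ₁ (i : Fin 3) : removeStrand strands i σ₁ = ![1, 1, τ] i := by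
  fin_cases i <;> rfl

theorem removeStrand_σ₂ (i : Fin 3) : removeStrand strands i σ₂ = ![τ, 1, 1] i := by
  fin_cases i <;> rfl

theorem removeStrand_ρ (i : Fin 3) : removeStrand strands i ρ = ![1, ρ₂, ρ₂] i := by
  fin_cases i <;> rfl

theorem removeStrand_u (i : Fin 3) : removeStrand strands i u = ![ρ₂, 1, u₂] i := by
  fin_cases i <;>
  simp [u, removeStrand_mul, removeStrand_inv, removeStrand_σ₁, removeStrand_ρ, perm_σ₁,
    perm_ρ, Equiv.swap_apply_def, u₂]

theorem removeStrand_w (i : Fin 3) : removeStrand strands i w = ![u₂, u₂, 1] i := by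
  fin_cases i <;>
  simp [w, removeStrand_mul, removeStrand_inv, removeStrand_σ₁, removeStrand_σ₂, removeStrand_ρ,
    perm_σ₁, perm_σ₂, perm_ρ, Equiv.swap_apply_def, u₂]

theorem removeStrand_A₂₃ (i : Fin 3) : removeStrand strands i A₂₃ = ![τ ^ 2, 1, 1] i := by
  fin_cases i <;>
  simp [A₂₃, pow_two, removeStrand_mul, removeStrand_σ₂, perm_σ₂, Equiv.swap_apply_def]

/-! ### Generators of the pure Cohen braids of the projective plane -/

theorem fibre_le_pure : fibre ≤ pureBraids strands := by
  rw [fibre, Subgroup.closure_le]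
  rintro x (rfl | rfl)
  · exact w_mem_pure
  · exact A₂₃_mem_pure

/-- A subgroup that contains what `w` and `A₂₃` leave upon removal of the `i`-th strand contains
what any braid of the fibre leaves. -/
theorem removePure_mem {f : pureBraids strands} (hf : (f : B₃) ∈ fibre) (i : Fin 3)
    {L : Subgroup B₂} (hw : removeStrand strands i w ∈ L)
    (hA : removeStrand strands i A₂₃ ∈ L) : removePure strands i f ∈ L := by
  have : fibre ≤ (L.comap (removePure strands i)).map (Subgroup.subtype _) := by
    rw [fibre, Subgroup.closure_le]
    rintro x (rfl | rfl)
    · exact ⟨⟨w, w_mem_pure⟩, hw, rfl⟩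
    · exact ⟨⟨A₂₃, A₂₃_mem_pure⟩, hA, rfl⟩
  obtain ⟨g, hg, hgf⟩ := this hf
  rwa [← Subtype.ext hgf]

theorem removePure_two_of_mem_fibre {f : pureBraids strands} (hf : (f : B₃) ∈ fibre) :
    removePure strands 2 f = 1 := by
  have := removePure_mem hf 2 (L := ⊥) (by simp [removeStrand_w]) (by simp [removeStrand_A₂₃])
  simpa using this

theorem removePure_zero_of_mem_fibre {f : pureBraids strands} (hf : (f : B₃) ∈ fibre) :
    removePure strands 0 f ∈ Subgroup.zpowers u₂ := by
  refine removePure_mem hf 0 (by simp [removeStrand_w]) ?_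
  rw [removeStrand_A₂₃]
  exact ⟨2, by simpa using u₂_sq⟩

/-- The braids generated by `kernelGens w A₂₃` are pure and become trivial whichever strand is
removed. -/
theorem removePure_eq_one_of_mem_closure {k : B₃}
    (hk : k ∈ Subgroup.closure (kernelGens w A₂₃)) :
    ∃ h : k ∈ pureBraids strands, ∀ i, removePure strands i ⟨k, h⟩ = 1 := by
  have e : Subgroup.closure (kernelGens w A₂₃) =
      (Subgroup.closure (kernelGens (⟨w, w_mem_pure⟩ : pureBraids strands)
        ⟨A₂₃, A₂₃_mem_pure⟩)).map (Subgroup.subtype _) := by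
    rw [MonoidHom.map_closure, image_kernelGens]
    rfl
  rw [e] at hk
  obtain ⟨k, hk, rfl⟩ := hk
  refine ⟨k.2, fun i => closure_kernelGens_le_ker (f := removePure strands i) ?_ ?_ ?_ hk⟩
  · change Commute (removeStrand strands i w) (removeStrand strands i A₂₃)
    rw [removeStrand_w, removeStrand_A₂₃, ← u₂_sq]
    fin_cases i <;> simp
  · change removeStrand strands i w ^ 4 = 1
    have : u₂ ^ 4 = 1 := by
      rw [show 4 = 2 * 2 from rfl, pow_mul, u₂_sq, ← pow_mul, τ_pow_four]
    rw [removeStrand_w]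
    fin_cases i <;> simp [this]
  · change removeStrand strands i A₂₃ ^ 2 = 1
    have : (τ ^ 2) ^ 2 = 1 := by rw [← pow_mul, τ_pow_four]
    rw [removeStrand_A₂₃]
    fin_cases i <;> simp [this]

/-- The braids of the fibre that are killed by the removal of any strand: removing the first two
strands from `w ^ i * A₂₃ ^ j * k` leaves `u₂ ^ (i + 2 * j)` and `u₂ ^ i`, where `u₂` has
order `4`. -/
theorem mem_closure_kernelGens_of_removePure_eq_one {f : pureBraids strands}
    (hf : (f : B₃) ∈ fibre) (h₀ : removePure strands 0 f = 1) (h₁ : removePure strands 1 f = 1) :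
    (f : B₃) ∈ Subgroup.closure (kernelGens w A₂₃) := by
  obtain ⟨i, j, k, hk, hfk⟩ := exists_mem_closure_kernelGens hf
  obtain ⟨hk', hk1⟩ := removePure_eq_one_of_mem_closure hk
  have hf' : f = (⟨w, w_mem_pure⟩ : pureBraids strands) ^ i *
      (⟨A₂₃, A₂₃_mem_pure⟩ : pureBraids strands) ^ j * ⟨k, hk'⟩ := by
    ext
    simpa using hfk
  have key : ∀ l, removePure strands l f =
      removeStrand strands l w ^ i * removeStrand strands l A₂₃ ^ j := by
    intro l
    rw [hf', map_mul, map_mul, map_zpow, map_zpow, hk1, mul_one]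
    rfl
  rw [key, removeStrand_w, removeStrand_A₂₃] at h₀ h₁
  have hi : (4 : ℤ) ∣ i := dvd_of_u₂_zpow_eq_one (by simpa using h₁)
  have hij : (4 : ℤ) ∣ i + 2 * j := by
    refine dvd_of_u₂_zpow_eq_one ?_
    rw [zpow_add, zpow_mul]
    have e : u₂ ^ (2 : ℤ) = τ ^ 2 := by simpa using u₂_sq
    rw [e]
    simpa using h₀
  obtain ⟨m, rfl⟩ := hi
  obtain ⟨n, rfl⟩ : (2 : ℤ) ∣ j := by omega
  rw [hfk, zpow_mul, zpow_mul]
  refine mul_mem (mul_mem (zpow_mem ?_ m) (zpow_mem ?_ n)) hk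
  · exact Subgroup.subset_closure (Or.inl (by simp))
  · exact Subgroup.subset_closure (Or.inr (Or.inl (by simp)))

theorem ρuw_mem_H₃ : ρ * u * w ∈ H₃ := by
  have h : ∀ i, removeStrand strands i (ρ * u * w) = ρ₂ * u₂ := by
    intro i
    have hρ : perm strands ρ = 1 := ρ_mem_pure
    have hu : perm strands u = 1 := u_mem_pure
    simp only [removeStrand_mul, map_mul, hρ, hu, removeStrand_ρ, removeStrand_u, removeStrand_w]
    fin_cases i <;> simp
  exact ⟨fun i j => by rw [h, h], mul_mem (mul_mem ρ_mem_pure u_mem_pure) w_mem_pure⟩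

/-- A pure braid is, up to a braid of the fibre, a power of `ρ * u * w` or such a power times `ρ`:
modulo the fibre these are the words in `σ₁` and `ρ` with trivial permutation. -/
theorem exists_mem_fibre_of_mem_pure {β : B₃} (hβ : β ∈ pureBraids strands) :
    ∃ i : ℤ, ∃ f ∈ fibre, β = (ρ * u * w) ^ i * f ∨ β = (ρ * u * w) ^ i * (ρ * f) := by
  obtain ⟨y, rfl, hy⟩ := mem_saturation.1 (pure_le_lifts hβ)
  set s : Subgroup.normalizer (fibre : Set B₃) := ⟨σ₁, σ₁_mem_normalizer⟩ with hs
  set r : Subgroup.normalizer (fibre : Set B₃) := ⟨ρ, ρ_mem_normalizer⟩ with hr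
  have hnorm : ρ * u * w ∈ Subgroup.normalizer (fibre : Set B₃) :=
    mul_mem (mul_mem ρ_mem_normalizer (mul_mem (mul_mem σ₁_mem_normalizer ρ_mem_normalizer)
      (inv_mem σ₁_mem_normalizer))) (Subgroup.le_normalizer w_mem_fibre)
  set c : Subgroup.normalizer (fibre : Set B₃) := ⟨ρ * u * w, hnorm⟩ with hc
  -- Modulo the fibre, `r * s * r * s⁻¹` is `ρ * u`, and so is `ρ * u * w`.
  have hrsrs : normalizerMk fibre (r * s * r * s⁻¹) = normalizerMk fibre c := by
    rw [normalizerMk_eq_iff]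
    have e : (((r * s * r * s⁻¹ : Subgroup.normalizer (fibre : Set B₃)) : B₃))⁻¹ * c = w := by
      simp [hs, hr, hc, u, mul_assoc]
    rw [e]
    exact w_mem_fibre
  have hsplit : ∀ (i : ℤ) (z : Subgroup.normalizer (fibre : Set B₃)),
      normalizerMk fibre y =
        normalizerMk fibre (r * s * r * s⁻¹) ^ i * normalizerMk fibre z →
      ∃ f ∈ fibre, (y : B₃) = (ρ * u * w) ^ i * (z * f) := by
    intro i z h
    rw [hrsrs, ← map_zpow, ← map_mul, eq_comm, normalizerMk_eq_iff] at h
    exact ⟨_, h, by simp [hc, mul_assoc]⟩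
  have hperm : ∀ (i : ℤ) (z f : B₃), f ∈ fibre → (y : B₃) = (ρ * u * w) ^ i * (z * f) →
      z ∈ pureBraids strands := by
    intro i z f hf h
    have hp : ρ * u * w ∈ pureBraids strands := ρuw_mem_H₃.2
    have e : z = ((ρ * u * w) ^ i)⁻¹ * y * f⁻¹ := by rw [h]; group
    rw [e]
    exact mul_mem (mul_mem (inv_mem (zpow_mem hp i)) hβ) (inv_mem (fibre_le_pure hf))
  have hσ₁ : σ₁ ∉ pureBraids strands := by
    intro h
    have h' : Equiv.swap (0 : Fin 3) 1 = 1 := h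
    revert h'
    decide
  have hrel₁ : s⁻¹ * r * s⁻¹ * r = r * s⁻¹ * r * s := Subtype.ext σ₁_ρ_rel
  have hrel₂ : normalizerMk fibre (r ^ 2) = normalizerMk fibre (s ^ 2) := by
    rw [eq_comm, normalizerMk_eq_iff]
    have e : (σ₁ ^ 2)⁻¹ * ρ ^ 2 = w ^ 2 * A₂₃⁻¹ := by
      rw [← σ₁_inv_conj_A₂₃, ρ_sq, A₂₃]
      simp only [pow_two]
      group
    change (σ₁ ^ 2)⁻¹ * ρ ^ 2 ∈ fibre
    rw [e]
    exact mul_mem (pow_mem w_mem_fibre 2) (inv_mem A₂₃_mem_fibre)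
  obtain ⟨i, h⟩ := exists_normal_form
    (s := normalizerMk fibre s) (r := normalizerMk fibre r)
    (by simp only [← map_mul, ← map_inv, hrel₁])
    (by simpa only [map_pow] using hrel₂) hy
  simp only [← map_mul, ← map_inv] at h
  refine ⟨i, ?_⟩
  rcases h with h | h | h | h
  · obtain ⟨f, hf, hy⟩ := hsplit i 1 (by rw [h, map_one, mul_one])
    exact ⟨f, hf, Or.inl (by simpa using hy)⟩
  · obtain ⟨f, hf, hy⟩ := hsplit i r h
    exact ⟨f, hf, Or.inr hy⟩
  · obtain ⟨f, hf, hy⟩ := hsplit i s h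
    exact absurd (hperm i _ f hf hy) hσ₁
  · obtain ⟨f, hf, hy⟩ := hsplit i (r * s) h
    exact absurd ((Subgroup.mul_mem_cancel_left _ ρ_mem_pure).1 (hperm i _ f hf hy)) hσ₁

theorem H₃_eq_closure : H₃ = Subgroup.closure (insert (ρ * u * w) (kernelGens w A₂₃)) := by
  apply le_antisymm
  · intro β hβ
    have hc : ρ * u * w ∈ Subgroup.closure (insert (ρ * u * w) (kernelGens w A₂₃)) :=
      Subgroup.subset_closure (Set.mem_insert _ _)
    obtain ⟨i, f, hf, h⟩ := exists_mem_fibre_of_mem_pure hβ.2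
    have hfp := fibre_le_pure hf
    have hγ : ((ρ * u * w) ^ i)⁻¹ * β ∈ H₃ := mul_mem (inv_mem (zpow_mem ρuw_mem_H₃ i)) hβ
    rcases h with rfl | rfl
    · rw [inv_mul_cancel_left] at hγ
      obtain ⟨hp, heq⟩ := mem_pureCohenBraids.1 hγ
      have h2 : removePure strands 2 ⟨f, hp⟩ = 1 := removePure_two_of_mem_fibre hf
      have := mem_closure_kernelGens_of_removePure_eq_one (f := ⟨f, hp⟩) hf
        ((heq 0 2).trans h2) ((heq 1 2).trans h2)
      exact mul_mem (zpow_mem hc i) (Subgroup.closure_mono (Set.subset_insert _ _) this)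
    · -- Removing the third strand leaves `ρ₂`, removing the first a power of `u₂`.
      rw [inv_mul_cancel_left] at hγ
      obtain ⟨hp, heq⟩ := mem_pureCohenBraids.1 hγ
      have hl : ∀ l, removePure strands l ⟨ρ * f, hp⟩ =
          removeStrand strands l ρ * removePure strands l ⟨f, hfp⟩ := fun l =>
        map_mul (removePure strands l) ⟨ρ, ρ_mem_pure⟩ ⟨f, hfp⟩
      have h := heq 0 2
      rw [hl, hl, removePure_two_of_mem_fibre (f := ⟨f, hfp⟩) hf, removeStrand_ρ,
        removeStrand_ρ] at h
      have h' : removePure strands 0 ⟨f, hfp⟩ = ρ₂ := by simpa using h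
      exact absurd (h' ▸ removePure_zero_of_mem_fibre (f := ⟨f, hfp⟩) hf) ρ₂_notMem_zpowers_u₂
  · rw [Subgroup.closure_le]
    rintro x (rfl | hx)
    · exact ρuw_mem_H₃
    · obtain ⟨h, h1⟩ := removePure_eq_one_of_mem_closure (Subgroup.subset_closure hx)
      exact mem_pureCohenBraids.2 ⟨h, fun i j => by rw [h1, h1]⟩

end RP2

namespace Disc

/-! ### An affine representation of the braid group of the disc -/

/-- The affine bijection `x ↦ a * x + b` of the rational line. -/
def affine (a : ℚˣ) (b : ℚ) : Equiv.Perm ℚ where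
  toFun x := a * x + b
  invFun x := a⁻¹ * (x - b)
  left_inv x := by simp
  right_inv x := by simp

theorem affine_apply (a : ℚˣ) (b x : ℚ) : affine a b x = a * x + b := rfl

theorem affine_one_zero : affine 1 0 = 1 := by
  ext x
  simp [affine_apply]

theorem affine_mul (a a' : ℚˣ) (b b' : ℚ) :
    affine a b * affine a' b' = affine (a * a') (a * b' + b) := by
  ext x
  simp only [Equiv.Perm.mul_apply, affine_apply, Units.val_mul]
  ring

theorem affine_inv (a : ℚˣ) (b : ℚ) : (affine a b)⁻¹ = affine a⁻¹ (-(a⁻¹ * b)) := by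
  rw [inv_eq_iff_mul_eq_one, affine_mul, ← affine_one_zero]
  simp

/-- A nonzero rational number as a unit. -/
def unit (q : ℚ) (hq : q ≠ 0 := by norm_num) : ℚˣ := Units.mk0 q hq

/-- Values on the generators of a homomorphism from `B₃` to the wreath product of the affine
bijections of `ℚ` with the permutations of the strands.  It is induced from the representation
`σ₁ ↦ (x ↦ -x / 4)`, `σ₂ ^ 2 ↦ (x ↦ 4 * x - 4)` of the stabilizer of the third strand, the coset
representatives being scaled so that the linear part of each coordinate depends only on the braids
left by the removal of the strands (see `exists_affine`). -/
def affineGen : Gen₃ → StrandWreath (Equiv.Perm ℚ) 3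
  | .σ₁ => ⟨![affine (unit 2) 4, affine (unit 2) 0, affine (unit (-1 / 4)) 0], Equiv.swap 0 1⟩
  | .σ₂ => ⟨![affine (unit (-1 / 4)) 0, affine (unit 2) (-2), affine (unit 2) 0], Equiv.swap 1 2⟩

theorem affineGen_rels : ∀ r ∈ rels₃, FreeGroup.lift affineGen r = 1 := by
  intro r hr
  simp only [rels₃, Set.mem_singleton_iff] at hr
  subst hr
  simp only [map_mul, map_inv, FreeGroup.lift_apply_of, mul_inv_eq_one]
  refine SemidirectProduct.ext ?_ ?_
  · funext i
    ext x
    fin_cases i <;>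
    simp [affineGen, wreath_mul_left, Equiv.swap_apply_def, affine, unit,
      -SemidirectProduct.mul_left] <;> ring
  · simp only [affineGen, SemidirectProduct.mul_right]
    decide

/-- The affine representation given by `affineGen`, with the permutation of the strands. -/
def toAffine : B₃ →* StrandWreath (Equiv.Perm ℚ) 3 :=
  PresentedGroup.toGroup affineGen_rels

/-- The first standard generator of the braid group of the disc on three strands. -/
def σ₁ : B₃ := PresentedGroup.of .σ₁

/-- The second standard generator of the braid group of the disc on three strands. -/
def σ₂ : B₃ := PresentedGroup.of .σ₂

theorem closure_generators : Subgroup.closure {σ₁, σ₂} = (⊤ : Subgroup B₃) := by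
  rw [eq_top_iff, ← PresentedGroup.closure_range_of]
  refine Subgroup.closure_mono ?_
  rintro _ ⟨g, rfl⟩
  cases g
  · exact Or.inl rfl
  · exact Or.inr rfl

theorem perm_σ₁ : perm strands σ₁ = Equiv.swap 0 1 := rfl

theorem perm_σ₂ : perm strands σ₂ = Equiv.swap 1 2 := rfl

theorem perm_toAffine (β : B₃) : perm toAffine β = perm strands β := by
  have : perm toAffine = perm strands := by
    refine PresentedGroup.ext fun g => ?_
    cases g <;> rfl
  rw [this]

/-- The character of the two-strand braid group of the disc that sends its generator to `q`. -/
def character (q : ℚˣ) : B₂ →* ℚˣ := FreeGroup.lift fun _ => q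

theorem character_of (q : ℚˣ) (x : Unit) : character q (FreeGroup.of x) = q :=
  FreeGroup.lift_apply_of

theorem character_mul (p q : ℚˣ) (α : B₂) :
    character (p * q) α = character p α * character q α := by
  have : character (p * q) = character p * character q := by
    ext
    simp [character]
  rw [this, MonoidHom.mul_apply]

/-- The product over all strands of a character of the braids left by their removal. -/
def totalCharacter (q : ℚˣ) : B₃ →* ℚˣ where
  toFun β := ∏ i, character q (removeStrand strands i β)
  map_one' := by simp [removeStrand_one]
  map_mul' β γ := by
    simp only [removeStrand_mul, map_mul, Finset.prod_mul_distrib]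
    congr 1
    exact Equiv.prod_comp (perm strands β)⁻¹ fun i => character q (removeStrand strands i γ)

theorem removeStrand_σ₁ (i : Fin 3) :
    removeStrand strands i σ₁ = ![1, 1, FreeGroup.of ()] i := by
  fin_cases i <;> rfl

theorem removeStrand_σ₂ (i : Fin 3) :
    removeStrand strands i σ₂ = ![FreeGroup.of (), 1, 1] i := by
  fin_cases i <;> rfl

theorem totalCharacter_σ₁ (q : ℚˣ) : totalCharacter q σ₁ = q := by
  simp [totalCharacter, removeStrand_σ₁, Fin.prod_univ_three, character_of]

theorem totalCharacter_σ₂ (q : ℚˣ) : totalCharacter q σ₂ = q := by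
  simp [totalCharacter, removeStrand_σ₂, Fin.prod_univ_three, character_of]

theorem removeStrand_toAffine_σ₁ (i : Fin 3) : removeStrand toAffine i σ₁ =
    ![affine (unit 2) 4, affine (unit 2) 0, affine (unit (-1 / 4)) 0] i := by
  fin_cases i <;> rfl

theorem removeStrand_toAffine_σ₂ (i : Fin 3) : removeStrand toAffine i σ₂ =
    ![affine (unit (-1 / 4)) 0, affine (unit 2) (-2), affine (unit 2) 0] i := by
  fin_cases i <;> rfl

/-- The linear part of the `i`-th coordinate of `toAffine β` is `(-1/4) ^ e i` times the product of
`2 ^ e j` over the other strands `j`, where `e j` is the exponent of `removeStrand strands j β`. -/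
theorem exists_affine (β : B₃) (i : Fin 3) : ∃ b : ℚ, removeStrand toAffine i β =
    affine (character (unit (-1 / 8)) (removeStrand strands i β) * totalCharacter (unit 2) β)
      b := by
  have hβ : β ∈ Subgroup.closure {σ₁, σ₂} := by rw [closure_generators]; trivial
  -- The total character also counts strand `i`, whence `-1 / 8` in place of `-1 / 4`.
  have hu : unit (-1 / 8) * unit 2 = unit (-1 / 4) := by
    ext
    norm_num [unit]
  induction hβ using Subgroup.closure_induction generalizing i with
  | mem g hg =>
    rcases hg with rfl | rfl
    · rw [totalCharacter_σ₁, removeStrand_toAffine_σ₁, removeStrand_σ₁]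
      fin_cases i
      · exact ⟨4, by simp⟩
      · exact ⟨0, by simp⟩
      · exact ⟨0, by simp [character_of, hu]⟩
    · rw [totalCharacter_σ₂, removeStrand_toAffine_σ₂, removeStrand_σ₂]
      fin_cases i
      · exact ⟨0, by simp [character_of, hu]⟩
      · exact ⟨-2, by simp⟩
      · exact ⟨0, by simp⟩
  | one => exact ⟨0, by simp [removeStrand_one, affine_one_zero]⟩
  | mul x y _ _ ihx ihy =>
    obtain ⟨b, hb⟩ := ihx i
    obtain ⟨c, hc⟩ := ihy ((perm strands x)⁻¹ i)
    rw [removeStrand_mul, perm_toAffine, hb, hc, removeStrand_mul, map_mul, map_mul, affine_mul,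
      mul_mul_mul_comm]
    exact ⟨_, rfl⟩
  | inv x _ ih =>
    obtain ⟨b, hb⟩ := ih (perm strands x i)
    rw [removeStrand_inv, perm_toAffine, hb, removeStrand_inv, map_inv, map_inv, affine_inv,
      mul_inv]
    exact ⟨_, rfl⟩

/-- Each crossing survives the removal of exactly one of the three strands. -/
theorem totalCharacter_neg_one (β : B₃) :
    totalCharacter (-1) β = Units.map (Int.castRingHom ℚ).toMonoidHom
      (Equiv.Perm.sign (perm strands β)) := by
  have : totalCharacter (-1) =
      (Units.map (Int.castRingHom ℚ).toMonoidHom).comp (Equiv.Perm.sign.comp (perm strands)) := by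
    refine PresentedGroup.ext fun g => ?_
    cases g
    · change totalCharacter (-1) σ₁ = Units.map (Int.castRingHom ℚ).toMonoidHom
        (Equiv.Perm.sign (perm strands σ₁))
      rw [totalCharacter_σ₁, perm_σ₁, Equiv.Perm.sign_swap (by decide)]
      ext; simp
    · change totalCharacter (-1) σ₂ = Units.map (Int.castRingHom ℚ).toMonoidHom
        (Equiv.Perm.sign (perm strands σ₂))
      rw [totalCharacter_σ₂, perm_σ₂, Equiv.Perm.sign_swap (by decide)]
      ext; simp
  rw [this]
  rfl

/-- If all strand removals of a braid give `α`, then the linear part of its action is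
`(-1 / 8 * 2 ^ 3) ^ e = (-1) ^ e` with `e` the exponent of `α`, and the permutation of the braid has
sign `(-1) ^ (3 * e)`, so that pure Cohen braids act by translations. -/
theorem exists_translation {β : B₃} (hβ : β ∈ H₃) :
    ∃ b : ℚ, removeStrand toAffine 2 β = affine 1 b := by
  obtain ⟨α, hα⟩ : ∃ α, ∀ i, removeStrand strands i β = α :=
    ⟨_, fun i => hβ.1 i 0⟩
  have htot : ∀ q, totalCharacter q β = character q α * character q α * character q α := by
    intro q
    change ∏ i, character q (removeStrand strands i β) = _
    simp only [hα, Fin.prod_univ_three]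
  have hpure : perm strands β = 1 := hβ.2
  have hsq : character (-1) α * character (-1) α = 1 := by
    rw [← character_mul]
    have : character (-1 * -1) = 1 := by
      ext
      simp [character]
    rw [this]
    rfl
  have hneg : character (-1) α = 1 := by
    have h := totalCharacter_neg_one β
    rwa [htot, hsq, one_mul, hpure, map_one, map_one] at h
  obtain ⟨b, hb⟩ := exists_affine β 2
  refine ⟨b, ?_⟩
  rw [hb, hα, htot, ← character_mul, ← character_mul, ← character_mul]
  have hu : unit (-1 / 8) * (unit 2 * unit 2 * unit 2) = -1 := by
    ext
    norm_num [unit]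
  rw [hu, hneg]

theorem mem_pureBraids_toAffine {β : B₃} (hβ : β ∈ pureBraids strands) :
    β ∈ pureBraids toAffine :=
  (perm_toAffine β).trans hβ

theorem H₃_le_pureBraids_toAffine : H₃ ≤ pureBraids toAffine :=
  fun _ hβ => mem_pureBraids_toAffine hβ.2

/-- The translation by which a pure Cohen braid acts on the rational line that belongs to the third
strand, given as the image of `0`. -/
def translation : H₃ →* Multiplicative ℚ where
  toFun β := Multiplicative.ofAdd (removeStrand toAffine 2 (β : B₃) 0)
  map_one' := by simp [removeStrand_one]
  map_mul' β γ := by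
    have h : perm toAffine β = 1 := H₃_le_pureBraids_toAffine β.2
    obtain ⟨b, hb⟩ := exists_translation β.2
    obtain ⟨c, hc⟩ := exists_translation γ.2
    simp [removeStrand_mul, h, hb, hc, affine_apply, ← ofAdd_add, add_comm]

/-! ### Pure Cohen braids of the disc are not finitely generated -/

theorem exists_common_denominator {P : Subgroup (Multiplicative ℚ)} (hP : P.FG) :
    ∃ N : ℕ, N ≠ 0 ∧ ∀ x ∈ P, ∃ z : ℤ, (N : ℚ) * x.toAdd = z := by
  obtain ⟨S, rfl⟩ := hP
  refine ⟨∏ x ∈ S, x.toAdd.den, Finset.prod_ne_zero_iff.2 fun x _ => x.toAdd.den_nz, ?_⟩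
  intro x hx
  induction hx using Subgroup.closure_induction with
  | mem x hx =>
    obtain ⟨m, hm⟩ := Finset.dvd_prod_of_mem (fun x : Multiplicative ℚ => x.toAdd.den) hx
    refine ⟨m * x.toAdd.num, ?_⟩
    rw [hm]
    push_cast
    rw [mul_right_comm, mul_comm (x.toAdd.den : ℚ), Rat.mul_den_eq_num, mul_comm]
  | one => exact ⟨0, by simp⟩
  | mul x y _ _ ihx ihy =>
    obtain ⟨a, ha⟩ := ihx
    obtain ⟨b, hb⟩ := ihy
    exact ⟨a + b, by rw [toAdd_mul, mul_add, ha, hb]; push_cast; rfl⟩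
  | inv x _ ih =>
    obtain ⟨a, ha⟩ := ih
    exact ⟨-a, by rw [toAdd_inv, mul_neg, ha]; push_cast; rfl⟩

theorem σ₁_sq_mem_pure : σ₁ ^ 2 ∈ pureBraids strands := by
  change perm strands (σ₁ ^ 2) = 1
  rw [map_pow, perm_σ₁]
  decide

theorem σ₂_sq_mem_pure : σ₂ ^ 2 ∈ pureBraids strands := by
  change perm strands (σ₂ ^ 2) = 1
  rw [map_pow, perm_σ₂]
  decide

/-- Commutators of pure braids become trivial when a strand is removed, the braid group on two
strands being abelian. -/
theorem conj_commutator_mem_H₃ (n : ℕ) :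
    (σ₁ ^ 2) ^ n * comm (σ₁ ^ 2) (σ₂ ^ 2) * ((σ₁ ^ 2) ^ n)⁻¹ ∈ H₃ := by
  let x : pureBraids strands := ⟨σ₁ ^ 2, σ₁_sq_mem_pure⟩
  let y : pureBraids strands := ⟨σ₂ ^ 2, σ₂_sq_mem_pure⟩
  have h : ∀ i, removePure strands i (x ^ n * comm x y * (x ^ n)⁻¹) = 1 := by
    intro i
    have hc : Commute (removePure strands i x) (removePure strands i y) := by
      change Commute (removeStrand strands i (σ₁ ^ 2)) (removeStrand strands i (σ₂ ^ 2))
      simp only [pow_two, removeStrand_mul, removeStrand_σ₁, removeStrand_σ₂, perm_σ₁, perm_σ₂]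
      fin_cases i <;> simp [Equiv.swap_apply_def]
    rw [map_mul, map_mul, map_comm, comm_eq_one_of_commute hc,
      mul_one, ← map_mul, mul_inv_cancel, map_one]
  exact mem_pureCohenBraids.2 ⟨(x ^ n * comm x y * (x ^ n)⁻¹).2, fun i j => (h i).trans (h j).symm⟩

/-- Since `σ₁ ^ 2` acts by `x ↦ x / 16`, conjugation by it divides translations by `16`. -/
theorem translation_conj_commutator (n : ℕ) :
    (translation ⟨_, conj_commutator_mem_H₃ n⟩).toAdd = (1 / 16) ^ n * 15 := by
  let x : pureBraids toAffine := ⟨σ₁ ^ 2, mem_pureBraids_toAffine σ₁_sq_mem_pure⟩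
  let y : pureBraids toAffine := ⟨σ₂ ^ 2, mem_pureBraids_toAffine σ₂_sq_mem_pure⟩
  have hx : removePure toAffine 2 x = affine (unit (1 / 16)) 0 := by
    change removeStrand toAffine 2 (σ₁ ^ 2) = _
    simp only [pow_two, removeStrand_mul, removeStrand_toAffine_σ₁, perm_toAffine, perm_σ₁]
    ext z
    simp [Equiv.swap_apply_def, affine_apply, unit]
    ring
  have hy : removePure toAffine 2 y = affine (unit 4) (-4) := by
    change removeStrand toAffine 2 (σ₂ ^ 2) = _
    simp only [pow_two, removeStrand_mul, removeStrand_toAffine_σ₂, perm_toAffine, perm_σ₂]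
    ext z
    simp [affine_apply, unit]
    ring
  have hpow : ∀ m : ℕ, affine (unit (1 / 16)) 0 ^ m = affine (unit (1 / 16) ^ m) 0 := by
    intro m
    induction m with
    | zero => simp [affine_one_zero]
    | succ m ih => rw [pow_succ, pow_succ, ih, affine_mul, mul_zero, add_zero]
  change removePure toAffine 2 (x ^ n * comm x y * (x ^ n)⁻¹) 0 = _
  rw [map_mul, map_mul, map_comm, map_inv, map_pow, hx, hy, hpow, affine_inv]
  simp [comm, affine_inv, affine_apply, unit]
  ring

theorem not_fg_H₃ : ¬ H₃.FG := by
  intro h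
  have : Group.FG H₃ := (Group.fg_iff_subgroup_fg H₃).2 h
  have hr : translation.range.FG := (Group.fg_iff_subgroup_fg _).1 inferInstance
  obtain ⟨N, hN, hz⟩ := exists_common_denominator hr
  -- The translations `15 / 16 ^ n` have unbounded denominators.
  obtain ⟨n, hn⟩ := exists_pow_lt_of_lt_one (show (0 : ℚ) < 1 / (N * 15) by positivity)
    (show (1 / 16 : ℚ) < 1 by norm_num)
  obtain ⟨z, hz⟩ := hz _ ⟨⟨_, conj_commutator_mem_H₃ n⟩, rfl⟩
  rw [translation_conj_commutator] at hz
  rw [lt_div_iff₀ (by positivity)] at hn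
  have hpos : (0 : ℚ) < N * ((1 / 16) ^ n * 15) := by positivity
  have h1 : (N : ℚ) * ((1 / 16) ^ n * 15) < 1 := by linarith
  rw [hz] at hpos h1
  have h2 : 0 < z := by exact_mod_cast hpos
  have h3 : z < 1 := by exact_mod_cast h1
  omega

end Disc

end CohenBraids

theorem mainTheorem10 :
    CohenBraids.RP2.H₃ =
      Subgroup.closure
        (open CohenBraids CohenBraids.RP2 in
        ({ρ * u * w,
          w ^ 4, A₂₃ ^ 2, comm (w ^ 4) A₂₃,
          comm A₂₃ w, comm A₂₃ (w ^ 2), comm A₂₃ (w ^ 3),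
          comm (comm A₂₃ w) A₂₃, comm (comm A₂₃ (w ^ 2)) A₂₃,
          comm (comm A₂₃ (w ^ 3)) A₂₃} : Set B₃)) ∧
    CohenBraids.RP2.H₃.FG ∧
    ¬ CohenBraids.Disc.H₃.FG := by
  have h := CohenBraids.RP2.H₃_eq_closure
  refine ⟨h, ?_, CohenBraids.Disc.not_fg_H₃⟩
  rw [Subgroup.fg_iff]
  exact ⟨_, h.symm, by simp [CohenBraids.kernelGens]⟩
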